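/- A stochastic game $G$ consists of a finite directed graph $(V,E)$ in which every vertex has an out-neighbour, a partition of $V$ into vertices of Player 1, vertices of Player 2 and probabilistic vertices, for every probabilistic vertex $v$ a probability distribution $\delta(v)$ on its out-neighbours with rational positive probabilities, and a rational payoff for every edge. A play is an infinite path $\rho$ in the graph. A strategy of a player is a map that sends every finite path ending in a vertex $v$ of this player to an out-neighbour of $v$; a pair of strategies $(\sigma,\tau)$ of Players 1 and 2 and an initial vertex $v$ determine a probability measure on plays, and $\mathbb E_v^{\sigma,\tau}$ denotes expectation under it. Let $f$ be a bounded Borel-measurable real-valued function on plays that is prefix-independent, i.e. $f(\rho)=f(\rho')$ whenever the plays $\rho,\rho'$ have a common suffix. The expected $f$-value of a vertex $v$ is $r_v=\sup_\sigma\inf_\tau \mathbb E_v^{\sigma,\tau}(f)$ (which equals $\inf_\tau\sup_\sigma \mathbb E_v^{\sigma,\tau}(f)$ by determinacy). The value classes are the parts of the partition of $V$ in which $u$ and $v$ are in the same part if and only if $r_u=r_v$; the value of a class is the common value of its vertices. A boundary vertex is a probabilistic vertex that has an out-neighbour outside its own value class. Let $P$ be the largest denominator (in lowest terms) of the probabilities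 $\delta(v)(v')$, over all edges $(v,v')$ with $v$ probabilistic ($P=1$ if there is no probabilistic vertex). Let $D'$ be a natural number such that the value of every value class without boundary vertices is a rational number whose denominator in lowest terms is at most $D'$. **Theorem.** The value of every value class of $G$ is a rational number whose denominator in lowest terms is at most $$2^{|V|}\cdot P^{|V|^3}\cdot (D')^{|V|}.$$ -/

import Mathlib

open MeasureTheory ProbabilityTheory

/-- Who moves the token at a vertex: the maximizing player, the minimizing player, or chance
(a probabilistic vertex). -/
inductive Owner : Type
  | main
  | adversary
  | random

/-- A two-player turn-based zero-sum stochastic game on the finite vertex set `V`, with rational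
transition probabilities. The map `owner` encodes the partition of the vertices into three parts.
The values of `prob` at a vertex that is not probabilistic, and those of `payoff` at a pair that is
not an edge, carry no meaning and are never used. -/
structure StochasticGame (V : Type*) [Fintype V] where
  Edge : V → V → Prop
  exists_edge : ∀ v, ∃ w, Edge v w
  owner : V → Owner
  prob : V → V → ℚ
  prob_pos : ∀ v w, owner v = Owner.random → Edge v w → 0 < prob v w
  prob_eq_zero : ∀ v w, owner v = Owner.random → ¬ Edge v w → prob v w = 0
  prob_sum : ∀ v, owner v = Owner.random → ∑ w, prob v w = 1
  payoff : V → V → ℚ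

/-- The real number `x` is rational, and its denominator in lowest terms is at most `N`. -/
def HasDenLE (x : ℝ) (N : ℕ) : Prop :=
  ∃ q : ℚ, (q : ℝ) = x ∧ q.den ≤ N

namespace StochasticGame

variable {V : Type*} [Fintype V]

/-- A play is an infinite path in the graph of the game. -/
abbrev Play (G : StochasticGame V) : Type _ :=
  {ρ : ℕ → V // ∀ i, G.Edge (ρ i) (ρ (i + 1))}

/-- A (deterministic) strategy of player `i`: it maps every finite sequence of vertices (the list
`l ++ [v]`, oldest vertex first) that ends in a vertex `v` of player `i` to an out-neighbour of `v`.
Values at other lists are irrelevant: they do not influence the distribution of the play. -/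
def Strategy (G : StochasticGame V) (i : Owner) : Type _ :=
  {σ : List V → V // ∀ (l : List V) (v : V), G.owner v = i → G.Edge v (σ (l ++ [v]))}

/-- A quantitative objective is prefix-independent if it takes the same value at any two plays with
a common suffix. -/
def PrefixIndependent (G : StochasticGame V) (f : G.Play → ℝ) : Prop :=
  ∀ ρ ρ' : G.Play, (∃ m n : ℕ, ∀ k, ρ.1 (m + k) = ρ'.1 (n + k)) → f ρ = f ρ'

/-- The part of the partition induced by the value vector `r` that contains the vertex `v`. -/
def valueClass (r : V → ℝ) (v : V) : Set V :=
  {u | r u = r v}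

/-- A boundary vertex, with respect to the value vector `r`, is a probabilistic vertex that has an
out-neighbour outside its own class. -/
def IsBoundary (G : StochasticGame V) (r : V → ℝ) (v : V) : Prop :=
  G.owner v = Owner.random ∧ ∃ w, G.Edge v w ∧ w ∉ valueClass r v

open Classical in
/-- The largest denominator (in lowest terms) of an edge probability, over all edges that leave
probabilistic vertices; it is `1` if there is no probabilistic vertex. -/
noncomputable def maxProbDen (G : StochasticGame V) : ℕ :=
  max 1 ((Finset.univ.filter fun e : V × V => G.owner e.1 = Owner.random ∧ G.Edge e.1 e.2).sup
    fun e => (G.prob e.1 e.2).den)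

/-- The finite history `v₀, …, vₙ` as a list. -/
def historyList {n : ℕ} (h : Finset.Iic n → V) : List V :=
  List.ofFn fun i : Fin (n + 1) => h ⟨i, Finset.mem_Iic.2 (Nat.le_of_lt_succ i.2)⟩

/-- The last vertex of the finite history `v₀, …, vₙ`. -/
def historyLast {n : ℕ} (h : Finset.Iic n → V) : V :=
  h ⟨n, Finset.mem_Iic.2 le_rfl⟩

variable [MeasurableSpace V] [DiscreteMeasurableSpace V]

/-- The distribution of the next vertex after a finite history, under a pair of strategies. -/
noncomputable def step (G : StochasticGame V) (σ : G.Strategy Owner.main)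
    (τ : G.Strategy Owner.adversary) (n : ℕ) (h : Finset.Iic n → V) : Measure V :=
  match G.owner (historyLast h) with
  | Owner.main => Measure.dirac (σ.1 (historyList h))
  | Owner.adversary => Measure.dirac (τ.1 (historyList h))
  | Owner.random =>
      ∑ w, ENNReal.ofReal ((G.prob (historyLast h) w : ℚ) : ℝ) • Measure.dirac w

/-- The transition kernels of the stochastic process that a pair of strategies induces. -/
noncomputable def stepKernel (G : StochasticGame V) (σ : G.Strategy Owner.main)
    (τ : G.Strategy Owner.adversary) (n : ℕ) : Kernel (Finset.Iic n → V) V where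
  toFun := G.step σ τ n
  measurable' := measurable_of_finite _

instance (G : StochasticGame V) (σ : G.Strategy Owner.main) (τ : G.Strategy Owner.adversary)
    (n : ℕ) : IsMarkovKernel (G.stepKernel σ τ n) := by
  refine ⟨fun h => ?_⟩
  change IsProbabilityMeasure (G.step σ τ n h)
  unfold step
  split
  · infer_instance
  · infer_instance
  · rename_i hr
    refine ⟨?_⟩
    have h0 : ∀ w ∈ Finset.univ, 0 ≤ ((G.prob (historyLast h) w : ℚ) : ℝ) := by
      intro w _
      by_cases hw : G.Edge (historyLast h) w
      · exact_mod_cast (G.prob_pos _ _ hr hw).le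
      · exact_mod_cast (G.prob_eq_zero _ _ hr hw).ge
    have h1 : ∑ w, ((G.prob (historyLast h) w : ℚ) : ℝ) = 1 := by
      exact_mod_cast G.prob_sum _ hr
    simp [← ENNReal.ofReal_sum_of_nonneg h0, h1]

/-- The probability measure on plays from the initial vertex `v` under a pair of strategies: the
measure on infinite sequences of vertices given by the transition kernels (Ionescu-Tulcea),
restricted to the set of plays, which has full measure. -/
noncomputable def playMeasure (G : StochasticGame V) (σ : G.Strategy Owner.main)
    (τ : G.Strategy Owner.adversary) (v : V) : Measure G.Play :=
  (Kernel.traj (X := fun _ => V) (G.stepKernel σ τ) 0 (fun _ => v)).comap Subtype.val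

/-- The expected `f`-value of the outcome of a pair of strategies from `v`. -/
noncomputable def expOutcome (G : StochasticGame V) (f : G.Play → ℝ) (σ : G.Strategy Owner.main)
    (τ : G.Strategy Owner.adversary) (v : V) : ℝ :=
  ∫ ρ, f ρ ∂(G.playMeasure σ τ v)

/-- The expected `f`-value of the vertex `v`. For a bounded Borel objective `f` such games are
determined, so that the supremum and the infimum may be exchanged. -/
noncomputable def expValue (G : StochasticGame V) (f : G.Play → ℝ) (v : V) : ℝ :=
  ⨆ σ : G.Strategy Owner.main, ⨅ τ : G.Strategy Owner.adversary, G.expOutcome f σ τ v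

end StochasticGame

/-!
The values are harmonic at the probabilistic vertices: `r v = ∑ w, δ(v)(w) * r w`
(`StochasticGame.expValue_eq_sum`). Indeed, if the first vertex `v` is probabilistic, the play
without `v` is a mixture of plays from the successors of `v` (`traj_map_shift`), and a
prefix-independent objective takes the same value on it. The strategies used after the different
successors are independent of each other, so supremum and infimum may be taken successor by
successor (`ciSup_sum_mul_of_glue`, `ciInf_sum_mul_of_glue`). In particular, determinacy plays no
role.

Now choose a boundary vertex in each value class that has one. For a vertex `v` of such a class the
harmonicity at the chosen vertex expresses `r v` as an average of values, and for the other vertices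
`r v` is a known rational number with denominator at most `D`. This is a linear system with one
equation per vertex. It is nonsingular: a boundary vertex has a successor of strictly larger value
(`StochasticGame.IsBoundary.exists_lt`), so a maximum principle applies to solutions of the
homogeneous system. After clearing the denominators of the probabilities, each row is integral with
sum of absolute values at most `2 * P ^ |V|`, so the determinant is at most
`2 ^ |V| * P ^ (|V| ^ 2)` in absolute value (`Matrix.abs_det_le_prod_sum_abs`), and Cramer's rule
bounds the denominators of the solution (`hasDenLE_of_forall_eq_average`).
-/

/-! ### A determinant bound -/

/-- The product of the row sums expands to a sum over all maps `n → n`, of which the permutations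
are a part. -/
theorem Matrix.abs_det_le_prod_sum_abs {n : Type*} [Fintype n] [DecidableEq n]
    (N : Matrix n n ℤ) : |N.det| ≤ ∏ i, ∑ j, |N i j| := by
  rw [← Matrix.det_transpose, Matrix.det_apply, Finset.prod_univ_sum]
  calc |∑ σ : Equiv.Perm n, Equiv.Perm.sign σ • ∏ i, N.transpose (σ i) i|
      ≤ ∑ σ : Equiv.Perm n, |Equiv.Perm.sign σ • ∏ i, N.transpose (σ i) i| :=
        Finset.abs_sum_le_sum_abs _ _
    _ = ∑ σ : Equiv.Perm n, ∏ i, |N i (σ i)| := by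
        refine Finset.sum_congr rfl fun σ _ => ?_
        rw [← Finset.abs_prod]
        rcases Int.units_eq_one_or (Equiv.Perm.sign σ) with h | h <;> simp [h]
    _ ≤ ∑ p ∈ Fintype.piFinset fun _ : n => (Finset.univ : Finset n), ∏ i, |N i (p i)| := by
        rw [← Finset.sum_image (s := Finset.univ) (g := fun σ : Equiv.Perm n => (σ : n → n))
          (f := fun p : n → n => ∏ i, |N i (p i)|) (fun _ _ _ _ h => DFunLike.coe_injective h)]
        exact Finset.sum_le_sum_of_subset_of_nonneg (fun _ _ => by simp)
          fun _ _ _ => Finset.prod_nonneg fun _ _ => abs_nonneg _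

/-! ### Denominators of solutions of linear systems -/

theorem Rat.den_dvd_of_mul_eq_intCast {q : ℚ} {k : ℕ} (hk : k ≠ 0) {m : ℤ}
    (h : (k : ℚ) * q = m) : q.den ∣ k := by
  have h1 : q = (m : ℚ) / ((k : ℤ) : ℚ) := by
    push_cast
    field_simp
    linarith
  have := Rat.den_dvd m (k : ℤ)
  rw [Rat.divInt_eq_div, ← h1] at this
  exact_mod_cast this

theorem Rat.exists_intCast_eq_mul_of_den_dvd {q : ℚ} {k : ℕ} (h : q.den ∣ k) :
    ∃ m : ℤ, (m : ℚ) = k * q := by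
  obtain ⟨c, rfl⟩ := h
  refine ⟨c * q.num, ?_⟩
  have := Rat.mul_den_eq_num q
  push_cast
  rw [← this]
  ring

/-- Cramer's rule as a bound on denominators: the solution of `N x = z` has denominators that divide
`det N` times a common denominator of `z`. -/
theorem hasDenLE_of_mulVec_eq {V : Type*} [Fintype V] [DecidableEq V] (N : Matrix V V ℤ)
    (hN : N.det ≠ 0) (x : V → ℝ) (z : V → ℚ) (h : ∀ v, ∑ w, (N v w : ℝ) * x w = z v)
    {Q : ℕ} (hQ : Q ≠ 0) (hz : ∀ v, (z v).den ∣ Q) (v : V) :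
    HasDenLE (x v) (N.det.natAbs * Q) := by
  choose y hy using fun v => Rat.exists_intCast_eq_mul_of_den_dvd (hz v)
  have hc : (N.det : ℝ) * x v = ∑ w, (N.adjugate v w : ℝ) * z w := by
    have h1 : (N.map (Int.castRingHom ℝ)).mulVec x = fun v => (z v : ℝ) := by
      funext v
      simpa [Matrix.mulVec, dotProduct] using h v
    have h2 := congrArg (fun u => (N.map (Int.castRingHom ℝ)).adjugate.mulVec u v) h1
    simp only [Matrix.mulVec_mulVec, Matrix.adjugate_mul, Matrix.smul_mulVec, Matrix.one_mulVec,
      Pi.smul_apply, smul_eq_mul] at h2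
    have h3 := RingHom.map_adjugate (Int.castRingHom ℝ) N
    have h4 := RingHom.map_det (Int.castRingHom ℝ) N
    simp only [RingHom.mapMatrix_apply] at h3 h4
    rw [← h3, ← h4] at h2
    simpa [Matrix.mulVec, dotProduct] using h2
  have hd : (N.det : ℚ) ≠ 0 := by exact_mod_cast hN
  set q : ℚ := (∑ w, (N.adjugate v w : ℚ) * z w) / N.det with hq
  have hqd : (N.det : ℚ) * q = ∑ w, (N.adjugate v w : ℚ) * z w := by
    rw [hq]; field_simp
  have hm : ((N.det.natAbs * Q : ℕ) : ℚ) * q =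
      ((N.det.sign * ∑ w, N.adjugate v w * y w : ℤ) : ℚ) := by
    have h5 : ((N.det.natAbs : ℕ) : ℚ) = (N.det.sign : ℚ) * N.det := by
      rw [← Int.cast_mul, Int.sign_mul_self_eq_natAbs, Int.cast_natCast]
    push_cast
    simp only [hy]
    rw [h5, mul_assoc, mul_assoc, mul_left_comm (N.det : ℚ), hqd, Finset.mul_sum]
    congr 1
    exact Finset.sum_congr rfl fun _ _ => by ring
  have hk : N.det.natAbs * Q ≠ 0 := mul_ne_zero (by simpa using hN) hQ
  refine ⟨q, ?_, Nat.le_of_dvd (Nat.pos_of_ne_zero hk) (Rat.den_dvd_of_mul_eq_intCast hk hm)⟩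
  have hd' : (N.det : ℝ) ≠ 0 := by exact_mod_cast hN
  apply mul_left_cancel₀ hd'
  rw [hc]
  have hqr := congrArg (Rat.cast : ℚ → ℝ) hqd
  simp only [Rat.cast_mul, Rat.cast_sum, Rat.cast_intCast] at hqr
  exact hqr

/-- Let `r v` be an average of the values of `r` with weights `a v`, for `v` in `K`, and known for
the other `v`. If each average involves a value larger than `r v`, then the linear system formed by
these equations has a unique solution, and its denominators are bounded by those of the weights and
of the known values. -/
theorem hasDenLE_of_forall_eq_average {V : Type*} [Fintype V] (r : V → ℝ) (K : V → Prop)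
    (a : V → V → ℚ) (ha : ∀ v, K v → ∀ w, 0 ≤ a v w) (hsum : ∀ v, K v → ∑ w, a v w = 1)
    (havg : ∀ v, K v → r v = ∑ w, (a v w : ℝ) * r w)
    (hup : ∀ v, K v → ∃ w, 0 < a v w ∧ r v < r w)
    {P D : ℕ} (hP : 1 ≤ P) (hden : ∀ v, K v → ∀ w, (a v w).den ≤ P)
    (hD : 1 ≤ D) (hr : ∀ v, ¬ K v → HasDenLE (r v) D) (v : V) :
    HasDenLE (r v)
      (2 ^ Fintype.card V * P ^ (Fintype.card V ^ 2) * D ^ Fintype.card V) := by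
  classical
  -- Multiplying row `v` by `L v` makes its weights integers; these are the numbers `b v w`.
  let L : V → ℕ := fun v => ∏ w, (a v w).den
  have hLpos : ∀ v, 0 < L v := fun v => Finset.prod_pos fun w _ => (a v w).den_pos
  have hLdvd : ∀ v w, (a v w).den ∣ L v := fun v w =>
    Finset.dvd_prod_of_mem (fun w => (a v w).den) (Finset.mem_univ w)
  choose b hb using fun v w => Rat.exists_intCast_eq_mul_of_den_dvd (hLdvd v w)
  let N : Matrix V V ℤ := fun v w =>
    if K v then (if v = w then (L v : ℤ) else 0) - b v w else if v = w then 1 else 0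
  have hN : ∀ {R : Type} [CommRing R] (y : V → R) (v), ∑ w, (N v w : R) * y w =
      if K v then L v * y v - ∑ w, (b v w : R) * y w else y v := by
    intro R _ y v
    by_cases hv : K v <;> simp [N, hv, sub_mul, Finset.sum_sub_distrib, ite_mul]
  have hdet : N.det ≠ 0 := by
    intro h0
    obtain ⟨y, hy0, hy⟩ := Matrix.exists_mulVec_eq_zero_iff.2 h0
    have hy' : ∀ v, ∑ w, (N v w : ℤ) * y w = 0 := fun v => congrFun hy v
    obtain ⟨u, hu⟩ := Function.ne_iff.1 hy0
    have : Nonempty V := ⟨u⟩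
    obtain ⟨m, hm⟩ := Finite.exists_max fun v => |y v|
    have hmpos : 0 < |y m| := (abs_pos.2 hu).trans_le (hm u)
    -- `t` maximizes `r` among the maximizers of `|y|`. In the average that equals `y t`, some `w₀`
    -- with `r w₀ > r t` has positive weight. There `|y|` is not maximal, which makes the average
    -- strictly smaller than the maximum `|y t|`: a contradiction.
    obtain ⟨t, htm, ht⟩ := (Finset.univ.filter fun v => |y v| = |y m|).exists_max_image r
      ⟨m, by simp⟩
    simp only [Finset.mem_filter, Finset.mem_univ, true_and] at htm ht
    have hsys := hy' t
    have h1 := hN y t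
    simp only [Int.cast_id] at h1
    rw [hsys] at h1
    by_cases hK : K t
    · rw [if_pos hK] at h1
      obtain ⟨w₀, hw₀, hlt⟩ := hup t hK
      have hyw₀ : |y w₀| < |y m| := lt_of_le_of_ne (hm w₀) fun h => (ht w₀ h).not_gt hlt
      have h2 : (y t : ℚ) = ∑ w, a t w * y w := by
        have h3 : (L t : ℚ) * y t = ∑ w, (b t w : ℚ) * y w := by
          exact_mod_cast (sub_eq_zero.1 h1.symm)
        simp only [hb, mul_assoc, ← Finset.mul_sum] at h3
        exact mul_left_cancel₀ (by exact_mod_cast (hLpos t).ne') h3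
      have h4 : |(y m : ℚ)| < |(y m : ℚ)| := by
        calc |(y m : ℚ)| = |(y t : ℚ)| := by exact_mod_cast htm.symm
          _ ≤ ∑ w, |a t w * y w| := by rw [h2]; exact Finset.abs_sum_le_sum_abs _ _
          _ = ∑ w, a t w * |(y w : ℚ)| := by
              simp only [abs_mul, abs_of_nonneg (ha t hK _)]
          _ < ∑ w, a t w * |(y m : ℚ)| := by
              refine Finset.sum_lt_sum (fun w _ => ?_) ⟨w₀, Finset.mem_univ _, ?_⟩
              · exact mul_le_mul_of_nonneg_left (by exact_mod_cast hm w) (ha t hK w)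
              · exact mul_lt_mul_of_pos_left (by exact_mod_cast hyw₀) hw₀
          _ = |(y m : ℚ)| := by rw [← Finset.sum_mul, hsum t hK, one_mul]
      exact lt_irrefl _ h4
    · rw [if_neg hK] at h1
      rw [← htm, ← h1] at hmpos
      simp at hmpos
  have hrow : ∀ v, ∑ w, |N v w| ≤ ((2 * P ^ Fintype.card V : ℕ) : ℤ) := by
    intro v
    have hP1 : 1 ≤ P ^ Fintype.card V := Nat.one_le_pow _ _ hP
    by_cases hv : K v
    · have hb0 : ∀ w, 0 ≤ b v w := fun w => by
        have h : (0 : ℚ) ≤ b v w := by rw [hb]; exact mul_nonneg (by positivity) (ha v hv w)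
        exact_mod_cast h
      have hbs : ∑ w, b v w = L v := by
        have h : (∑ w, b v w : ℚ) = L v := by
          simp only [hb, ← Finset.mul_sum, hsum v hv, mul_one]
        exact_mod_cast h
      have hL : L v ≤ P ^ Fintype.card V := by
        simpa using Finset.prod_le_pow_card Finset.univ (fun w => (a v w).den) P
          fun w _ => hden v hv w
      calc ∑ w, |N v w| ≤ ∑ w, ((if v = w then (L v : ℤ) else 0) + b v w) := by
            refine Finset.sum_le_sum fun w _ => ?_
            simp only [N, if_pos hv]
            refine (abs_sub _ _).trans_eq ?_
            rw [abs_of_nonneg (hb0 w), abs_of_nonneg (by split_ifs <;> simp)]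
        _ = 2 * L v := by
            rw [Finset.sum_add_distrib, hbs]; simp; ring
        _ ≤ _ := by push_cast; exact_mod_cast Nat.mul_le_mul_left 2 hL
    · have : ∑ w, |N v w| = 1 := by
        simp only [N, if_neg hv, apply_ite abs, abs_one, abs_zero, Finset.sum_ite_eq,
          Finset.mem_univ, if_true]
      rw [this]
      exact_mod_cast (by omega : 1 ≤ 2 * P ^ Fintype.card V)
  choose q hq hqD using hr
  let z : V → ℚ := fun v => if hv : K v then 0 else q v hv
  have hz : ∀ v, (z v).den ≤ D := fun v => by
    by_cases hv : K v
    · simpa [z, hv] using hD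
    · simpa [z, hv] using hqD v hv
  have hsys : ∀ v, ∑ w, (N v w : ℝ) * r w = z v := by
    intro v
    rw [hN r v]
    by_cases hv : K v
    · have h : ∀ w, (b v w : ℝ) = L v * a v w := fun w => by
        exact_mod_cast congrArg ((↑) : ℚ → ℝ) (hb v w)
      simp only [if_pos hv, z, dif_pos hv, h, mul_assoc, ← Finset.mul_sum, ← havg v hv]
      simp
    · simp [z, hv, hq]
  obtain ⟨p, hp, hpd⟩ := hasDenLE_of_mulVec_eq N hdet r z hsys (Q := ∏ w, (z w).den)
    (Finset.prod_ne_zero_iff.2 fun w _ => (z w).den_ne_zero)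
    (fun v => Finset.dvd_prod_of_mem (fun w => (z w).den) (Finset.mem_univ v)) v
  refine ⟨p, hp, hpd.trans (Nat.mul_le_mul ?_ ?_)⟩
  · have h : |N.det| ≤ ((2 ^ Fintype.card V * P ^ (Fintype.card V ^ 2) : ℕ) : ℤ) := by
      refine (Matrix.abs_det_le_prod_sum_abs N).trans ?_
      refine (Finset.prod_le_prod (fun v _ => Finset.sum_nonneg fun w _ => abs_nonneg _)
        fun v _ => hrow v).trans_eq ?_
      simp [mul_pow, ← pow_mul, sq]
    rw [Int.abs_eq_natAbs] at h
    exact_mod_cast h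
  · simpa using Finset.prod_le_pow_card Finset.univ (fun w => (z w).den) D fun w _ => hz w

/-! ### Laws of stochastic processes on a finite state space -/

section Trajectories

open Preorder

variable {V : Type*}

/-- The sequences that agree with `h` up to time `n`. -/
def pathCylinder (n : ℕ) (h : ℕ → V) : Set (ℕ → V) :=
  frestrictLe (π := fun _ => V) n ⁻¹' {frestrictLe (π := fun _ => V) n h}

theorem mem_pathCylinder {n : ℕ} {h x : ℕ → V} : x ∈ pathCylinder n h ↔ ∀ i ≤ n, x i = h i := by
  simp [pathCylinder, funext_iff]

variable [MeasurableSpace V] [Finite V] [DiscreteMeasurableSpace V]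

theorem measurableSet_pathCylinder (n : ℕ) (h : ℕ → V) : MeasurableSet (pathCylinder n h) :=
  measurable_frestrictLe n (Set.toFinite _).measurableSet

/-- A finite measure on sequences is determined by the probabilities of finite prefixes. -/
theorem Measure.ext_of_pathCylinder {μ ν : Measure (ℕ → V)} [IsFiniteMeasure μ]
    (H : ∀ n h, μ (pathCylinder n h) = ν (pathCylinder n h)) : μ = ν := by
  -- Prefixes are extended to sequences by a default vertex, which exists unless `V` is empty.
  rcases isEmpty_or_nonempty V with hV | ⟨⟨v₀⟩⟩
  · have : IsEmpty (ℕ → V) := ⟨fun x => hV.false (x 0)⟩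
    exact Subsingleton.elim _ _
  have key : ∀ n, μ.map (frestrictLe (π := fun _ => V) n) = ν.map (frestrictLe n) := by
    intro n
    refine Measure.ext_of_singleton fun g => ?_
    obtain ⟨h, rfl⟩ : ∃ h : ℕ → V, frestrictLe (π := fun _ => V) n h = g :=
      ⟨fun i => if hi : i ≤ n then g ⟨i, Finset.mem_Iic.2 hi⟩ else v₀, by
        funext i
        simp [Finset.mem_Iic.1 i.2]⟩
    rw [Measure.map_apply (measurable_frestrictLe n) (measurableSet_singleton _),
      Measure.map_apply (measurable_frestrictLe n) (measurableSet_singleton _)]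
    exact H n h
  have hproj : ∀ I : Finset ℕ, μ.map I.restrict = ν.map I.restrict := by
    intro I
    rw [← Finset.restrict₂_comp_restrict I.subset_Iic_sup_id,
      ← Measure.map_map (by fun_prop) (by fun_prop), ← Measure.map_map (by fun_prop) (by fun_prop)]
    exact congrArg _ (key _)
  have hν : IsProjectiveLimit ν fun I : Finset ℕ => μ.map I.restrict := fun I => (hproj I).symm
  have hμ : IsProjectiveLimit μ fun I : Finset ℕ => μ.map I.restrict := fun I => rfl
  exact hμ.unique hν

variable (κ : (n : ℕ) → Kernel (Finset.Iic n → V) V) [∀ n, IsMarkovKernel (κ n)]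

theorem traj_pathCylinder_zero [DecidableEq V] (v : V) (h : ℕ → V) :
    Kernel.traj (X := fun _ => V) κ 0 (fun _ => v) (pathCylinder 0 h) =
      if v = h 0 then 1 else 0 := by
  classical
  rw [pathCylinder, ← Measure.map_apply (measurable_frestrictLe 0) (measurableSet_singleton _),
    Kernel.traj_map_frestrictLe_apply, Kernel.partialTraj_self, Kernel.id_apply,
    Measure.dirac_apply' _ (measurableSet_singleton _), Set.indicator_apply]
  have hiff : (fun _ => v) ∈ ({frestrictLe (π := fun _ => V) 0 h} : Set (Finset.Iic 0 → V)) ↔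
      v = h 0 := by
    simp [funext_iff]
  simp only [hiff, Pi.one_apply]

/-- The product formula: the probability of a prefix of length `n + 2` is that of the
prefix of length `n + 1` times the transition probability. -/
theorem traj_pathCylinder_succ (v : V) (n : ℕ) (h : ℕ → V) :
    Kernel.traj (X := fun _ => V) κ 0 (fun _ => v) (pathCylinder (n + 1) h) =
      Kernel.traj (X := fun _ => V) κ 0 (fun _ => v) (pathCylinder n h) *
        κ n (fun i => h i) {h (n + 1)} := by
  have key := congrArg (fun μ => μ ({frestrictLe (π := fun _ => V) n h} ×ˢ {h (n + 1)}))
    (Kernel.partialTraj_compProd_eq_map_traj (X := fun _ => V) (κ := κ) (Nat.zero_le n)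
      (x₀ := fun _ => v))
  beta_reduce at key
  rw [Measure.compProd_apply_prod (measurableSet_singleton _) (measurableSet_singleton _),
    Measure.map_apply (by fun_prop)
      ((measurableSet_singleton _).prod (measurableSet_singleton _)), lintegral_singleton,
    ← Kernel.traj_map_frestrictLe_apply,
    Measure.map_apply (measurable_frestrictLe n) (measurableSet_singleton _), mul_comm] at key
  refine Eq.trans (congrArg _ ?_) key.symm
  ext x
  rw [mem_pathCylinder]
  simp [funext_iff, Nat.le_succ_iff, or_imp, forall_and]


theorem traj_ae_apply_zero (v : V) :
    ∀ᵐ x ∂Kernel.traj (X := fun _ => V) κ 0 (fun _ => v), x 0 = v := by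
  classical
  have h := traj_pathCylinder_zero κ v (fun _ => v)
  rw [if_pos rfl] at h
  rw [← prob_compl_eq_zero_iff (measurableSet_pathCylinder _ _)] at h
  rw [ae_iff]
  convert h using 2
  ext x
  simp [mem_pathCylinder]

/-- The law of the trajectory from `v` depends only on the transitions after histories that start
at `v`. -/
theorem traj_congr_of_start {κ κ' : (n : ℕ) → Kernel (Finset.Iic n → V) V}
    [∀ n, IsMarkovKernel (κ n)] [∀ n, IsMarkovKernel (κ' n)] {v : V}
    (H : ∀ n (h : ℕ → V), h 0 = v → κ n (fun i => h i) = κ' n (fun i => h i)) :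
    Kernel.traj (X := fun _ => V) κ 0 (fun _ => v) =
      Kernel.traj (X := fun _ => V) κ' 0 (fun _ => v) := by
  classical
  refine Measure.ext_of_pathCylinder fun n h => ?_
  induction n with
  | zero => rw [traj_pathCylinder_zero, traj_pathCylinder_zero]
  | succ n ih =>
    by_cases hv : h 0 = v
    · rw [traj_pathCylinder_succ, traj_pathCylinder_succ, ih, H n h hv]
    · have hnull : ∀ (η : (n : ℕ) → Kernel (Finset.Iic n → V) V) [∀ n, IsMarkovKernel (η n)],
          Kernel.traj (X := fun _ => V) η 0 (fun _ => v) (pathCylinder (n + 1) h) = 0 := by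
        intro η _
        refine measure_mono_null ?_ (ae_iff.1 (traj_ae_apply_zero η v))
        intro x hx hx0
        exact hv (((mem_pathCylinder.1 hx) 0 (Nat.zero_le _)).symm.trans hx0)
      rw [hnull κ, hnull κ']

/-- One-step decomposition of a stochastic process: if `κ'` describes the transitions of `κ` after
the initial point `v` has been dropped from the history, then the trajectory from `v` without its
initial point is a mixture of trajectories of `κ'`. -/
theorem traj_map_shift {V : Type*} [MeasurableSpace V] [Fintype V] [DiscreteMeasurableSpace V]
    {κ κ' : (n : ℕ) → Kernel (Finset.Iic n → V) V}
    [∀ n, IsMarkovKernel (κ n)] [∀ n, IsMarkovKernel (κ' n)] {v : V}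
    (H : ∀ n (h : ℕ → V), h 0 = v → κ (n + 1) (fun i => h i) = κ' n (fun i => h (i + 1))) :
    (Kernel.traj (X := fun _ => V) κ 0 (fun _ => v)).map (fun x n => x (n + 1)) =
      ∑ w, κ 0 (fun _ => v) {w} • Kernel.traj (X := fun _ => V) κ' 0 (fun _ => w) := by
  classical
  have hshift : Measurable fun (x : ℕ → V) n => x (n + 1) := by fun_prop
  have : IsFiniteMeasure ((Kernel.traj (X := fun _ => V) κ 0 (fun _ => v)).map
      (fun x n => x (n + 1))) := inferInstance
  refine Measure.ext_of_pathCylinder fun n h => ?_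
  -- The sequence `v, h 0, h 1, …`.
  let h' : ℕ → V := fun k => Nat.casesOn k v h
  have hcyl : (Kernel.traj (X := fun _ => V) κ 0 (fun _ => v)).map (fun x n => x (n + 1))
      (pathCylinder n h) =
      Kernel.traj (X := fun _ => V) κ 0 (fun _ => v) (pathCylinder (n + 1) h') := by
    rw [Measure.map_apply hshift (measurableSet_pathCylinder n h)]
    refine measure_congr ?_
    filter_upwards [traj_ae_apply_zero κ v] with x hx
    refine propext ?_
    change (fun n => x (n + 1)) ∈ pathCylinder n h ↔ x ∈ pathCylinder (n + 1) h'
    rw [mem_pathCylinder, mem_pathCylinder]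
    constructor
    · rintro hi (_ | i) hle
      · exact hx
      · exact hi i (by omega)
    · intro hi i hle
      exact hi (i + 1) (by omega)
  have hprod : ∀ n, Kernel.traj (X := fun _ => V) κ 0 (fun _ => v) (pathCylinder (n + 1) h') =
      κ 0 (fun _ => v) {h 0} *
        Kernel.traj (X := fun _ => V) κ' 0 (fun _ => h 0) (pathCylinder n h) := by
    intro n
    induction n with
    | zero =>
      rw [traj_pathCylinder_succ, traj_pathCylinder_zero, traj_pathCylinder_zero, if_pos rfl,
        if_pos (show v = h' 0 from rfl), one_mul, mul_one]
      congr 2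
      funext i
      have hi : (i : ℕ) = 0 := Nat.le_zero.1 (Finset.mem_Iic.1 i.2)
      simp [hi, h']
    | succ n ih =>
      rw [traj_pathCylinder_succ, ih, traj_pathCylinder_succ κ', mul_assoc, H n h' rfl]
  rw [hcyl, hprod, Measure.finsetSum_apply, Finset.sum_eq_single (h 0)]
  · rfl
  · intro w _ hw
    have h0 : Kernel.traj (X := fun _ => V) κ' 0 (fun _ => w) (pathCylinder n h) = 0 := by
      refine measure_mono_null ?_ (ae_iff.1 (traj_ae_apply_zero κ' w))
      intro x hx hx0
      exact hw (hx0.symm.trans ((mem_pathCylinder.1 hx) 0 (Nat.zero_le _)))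
    rw [Measure.smul_apply, h0, smul_zero]
  · simp

end Trajectories

/-! ### Infima and suprema of averages -/

/-- The infimum of an average is the average of the infima, if the parameters of the summands can be
chosen independently. -/
theorem ciInf_sum_mul_of_glue {S W : Type*} [Fintype W] [Nonempty S] {φ : W → S → ℝ} {p : W → ℝ}
    (hp : ∀ w, 0 ≤ p w) (hp1 : ∑ w, p w = 1) (hb : ∀ w, BddBelow (Set.range (φ w)))
    (glue : ∀ s : W → S, ∃ t, ∀ w, φ w t = φ w (s w)) :
    ⨅ s, ∑ w, p w * φ w s = ∑ w, p w * ⨅ s, φ w s := by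
  have hle : ∀ s, ∑ w, p w * ⨅ s, φ w s ≤ ∑ w, p w * φ w s := fun s =>
    Finset.sum_le_sum fun w _ => mul_le_mul_of_nonneg_left (ciInf_le (hb w) s) (hp w)
  refine le_antisymm (le_of_forall_pos_le_add fun ε hε => ?_) (le_ciInf hle)
  choose s hs using fun w => exists_lt_of_ciInf_lt (lt_add_of_pos_right (⨅ s, φ w s) hε)
  obtain ⟨t, ht⟩ := glue s
  calc ⨅ s, ∑ w, p w * φ w s ≤ ∑ w, p w * φ w t := ciInf_le ⟨_, Set.forall_mem_range.2 hle⟩ t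
    _ ≤ ∑ w, p w * ((⨅ s, φ w s) + ε) := Finset.sum_le_sum fun w _ =>
        mul_le_mul_of_nonneg_left ((ht w).trans_le (hs w).le) (hp w)
    _ = ∑ w, p w * (⨅ s, φ w s) + ε := by
        simp only [mul_add, Finset.sum_add_distrib, ← Finset.sum_mul, hp1, one_mul]

/-- The dual of `ciInf_sum_mul_of_glue`. -/
theorem ciSup_sum_mul_of_glue {S W : Type*} [Fintype W] [Nonempty S] {φ : W → S → ℝ} {p : W → ℝ}
    (hp : ∀ w, 0 ≤ p w) (hp1 : ∑ w, p w = 1) (hb : ∀ w, BddAbove (Set.range (φ w)))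
    (glue : ∀ s : W → S, ∃ t, ∀ w, φ w t = φ w (s w)) :
    ⨆ s, ∑ w, p w * φ w s = ∑ w, p w * ⨆ s, φ w s := by
  have hle : ∀ s, ∑ w, p w * φ w s ≤ ∑ w, p w * ⨆ s, φ w s := fun s =>
    Finset.sum_le_sum fun w _ => mul_le_mul_of_nonneg_left (le_ciSup (hb w) s) (hp w)
  refine le_antisymm (ciSup_le hle) (le_of_forall_pos_le_add fun ε hε => ?_)
  choose s hs using fun w => exists_lt_of_lt_ciSup (sub_lt_self (⨆ s, φ w s) hε)
  obtain ⟨t, ht⟩ := glue s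
  calc ∑ w, p w * (⨆ s, φ w s) = ∑ w, p w * ((⨆ s, φ w s) - ε) + ε := by
        simp only [mul_sub, Finset.sum_sub_distrib, ← Finset.sum_mul, hp1, one_mul,
          sub_add_cancel]
    _ ≤ ∑ w, p w * φ w t + ε := by
        gcongr with w
        · exact hp w
        · exact (hs w).le.trans_eq (ht w).symm
    _ ≤ (⨆ s, ∑ w, p w * φ w s) + ε := by
        gcongr
        exact le_ciSup (f := fun s => ∑ w, p w * φ w s) ⟨_, Set.forall_mem_range.2 hle⟩ t

/-! ### Histories and strategies -/

namespace StochasticGame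

section Histories

variable {V : Type*}

theorem historyList_eq_cons {n : ℕ} (h : ℕ → V) :
    historyList (fun i : Finset.Iic n => h i) =
      h 0 :: List.ofFn fun i : Fin n => h (i + 1) := by
  simp [historyList, List.ofFn_succ]

theorem historyList_succ_eq_cons {n : ℕ} (h : ℕ → V) :
    historyList (fun i : Finset.Iic (n + 1) => h i) =
      h 0 :: historyList fun i : Finset.Iic n => h (i + 1) := by
  rw [historyList_eq_cons]
  rfl

end Histories

section Strategies

variable {V : Type*} [Fintype V] {G : StochasticGame V} {i : Owner}

theorem nonempty_strategy (G : StochasticGame V) (i : Owner) (v : V) :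
    Nonempty (G.Strategy i) := by
  choose s hs using G.exists_edge
  exact ⟨⟨fun l => s (l.getLast?.getD v), fun l u _ => by simpa using hs u⟩⟩

/-- The strategy that is left of `σ` when the play has started in `v`: it prepends `v` to the
history. -/
def Strategy.shift (v : V) (σ : G.Strategy i) : G.Strategy i :=
  ⟨fun l => σ.1 (v :: l), fun l u hu => σ.2 (v :: l) u hu⟩

/-- At a vertex that does not belong to player `i`, the player's behaviour after the first move is
unconstrained. -/
theorem Strategy.shift_surjective {v : V} (hv : G.owner v ≠ i) :
    Function.Surjective (Strategy.shift (G := G) (i := i) v) := by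
  classical
  intro σ
  obtain ⟨σ₀⟩ := nonempty_strategy G i v
  refine ⟨⟨fun l => if l.head? = some v then σ.1 l.tail else σ₀.1 l, fun l u hu => ?_⟩, ?_⟩
  · rcases l with _ | ⟨a, l⟩
    · have huv : u ≠ v := fun h => hv (h ▸ hu)
      simpa [huv] using σ₀.2 [] u hu
    · by_cases ha : a = v
      · simpa [ha] using σ.2 l u hu
      · simpa [ha] using σ₀.2 (a :: l) u hu
  · exact Subtype.ext (funext fun l => by simp [Strategy.shift])

/-- Strategies chosen separately for each initial vertex combine into a single one. -/
theorem Strategy.exists_glue (v : V) (s : V → G.Strategy i) :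
    ∃ t : G.Strategy i, ∀ w l, t.1 (w :: l) = (s w).1 (w :: l) := by
  refine ⟨⟨fun l => (s (l.head?.getD v)).1 l, fun l u hu => (s _).2 l u hu⟩, fun w l => ?_⟩
  simp

end Strategies

/-! ### Transition probabilities and objectives -/

section Graph

variable {V : Type*} [Fintype V] {G : StochasticGame V}

theorem prob_nonneg {v : V} (hv : G.owner v = Owner.random) (w : V) : 0 ≤ G.prob v w := by
  by_cases hw : G.Edge v w
  · exact (G.prob_pos v w hv hw).le
  · exact (G.prob_eq_zero v w hv hw).ge

/-- An objective, extended by zero to all sequences of vertices. -/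
noncomputable def extendByZero (G : StochasticGame V) (f : G.Play → ℝ) : (ℕ → V) → ℝ :=
  Function.extend Subtype.val f 0

theorem extendByZero_of_edge (f : G.Play → ℝ) {x : ℕ → V} (hx : ∀ i, G.Edge (x i) (x (i + 1))) :
    G.extendByZero f x = f ⟨x, hx⟩ :=
  Subtype.val_injective.extend_apply f 0 ⟨x, hx⟩

theorem extendByZero_of_not_edge (f : G.Play → ℝ) {x : ℕ → V}
    (hx : ¬ ∀ i, G.Edge (x i) (x (i + 1))) : G.extendByZero f x = 0 :=
  Function.extend_apply' _ _ _ fun ⟨ρ, hρ⟩ => hx (hρ ▸ ρ.2)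

theorem abs_extendByZero_le {f : G.Play → ℝ} {W : ℕ} (hW : ∀ ρ, |f ρ| ≤ W) (x : ℕ → V) :
    |G.extendByZero f x| ≤ W := by
  by_cases hx : ∀ i, G.Edge (x i) (x (i + 1))
  · rw [extendByZero_of_edge f hx]
    exact hW _
  · rw [extendByZero_of_not_edge f hx]
    simp

/-- The hypothesis on the first step is needed: without it the shifted sequence may be a play while
`x` is not. -/
theorem extendByZero_shift {f : G.Play → ℝ} (hpre : G.PrefixIndependent f) {x : ℕ → V}
    (hx : G.Edge (x 0) (x 1)) : G.extendByZero f x = G.extendByZero f fun n => x (n + 1) := by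
  by_cases h : ∀ i, G.Edge (x (i + 1)) (x (i + 1 + 1))
  · have h' : ∀ i, G.Edge (x i) (x (i + 1)) := by
      rintro (_ | i)
      exacts [hx, h i]
    rw [extendByZero_of_edge f h', extendByZero_of_edge (x := fun n => x (n + 1)) f h]
    exact hpre _ _ ⟨1, 0, fun k => by simp [add_comm]⟩
  · rw [extendByZero_of_not_edge (x := fun n => x (n + 1)) f h,
      extendByZero_of_not_edge f fun h' => h fun i => h' (i + 1)]

theorem one_le_maxProbDen (G : StochasticGame V) : 1 ≤ G.maxProbDen :=
  le_max_left _ _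

theorem den_prob_le_maxProbDen {v : V} (hv : G.owner v = Owner.random) (w : V) :
    (G.prob v w).den ≤ G.maxProbDen := by
  classical
  by_cases hw : G.Edge v w
  · refine le_trans ?_ (le_max_right _ _)
    exact Finset.le_sup (f := fun e : V × V => (G.prob e.1 e.2).den) (b := (v, w))
      (by simp [hv, hw])
  · rw [G.prob_eq_zero v w hv hw]
    exact one_le_maxProbDen G

/-- By harmonicity, a vertex with a successor of different value has one of larger value. -/
theorem IsBoundary.exists_lt {r : V → ℝ} {v : V} (hv : G.IsBoundary r v)
    (hr : r v = ∑ w, (G.prob v w : ℝ) * r w) : ∃ w, 0 < G.prob v w ∧ r v < r w := by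
  obtain ⟨hown, u, hu, hne⟩ := hv
  by_contra! H
  have hpos : 0 < G.prob v u := G.prob_pos v u hown hu
  refine hr.not_gt ?_
  calc ∑ w, (G.prob v w : ℝ) * r w < ∑ w, (G.prob v w : ℝ) * r v := by
        refine Finset.sum_lt_sum (fun w _ => ?_) ⟨u, Finset.mem_univ u, ?_⟩
        · by_cases hw : G.Edge v w
          · have := G.prob_pos v w hown hw
            exact mul_le_mul_of_nonneg_left (H w this) (by exact_mod_cast this.le)
          · simp [G.prob_eq_zero v w hown hw]
        · exact mul_lt_mul_of_pos_left (lt_of_le_of_ne (H u hpos) hne) (by exact_mod_cast hpos)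
    _ = r v := by
        have hsum : ∑ w, (G.prob v w : ℝ) = 1 := by exact_mod_cast G.prob_sum v hown
        rw [← Finset.sum_mul, hsum, one_mul]

end Graph

/-! ### Expected values of prefix-independent objectives -/

section Step

variable {V : Type*} [Fintype V] [MeasurableSpace V] {G : StochasticGame V}

theorem step_congr {σ σ' : G.Strategy Owner.main} {τ τ' : G.Strategy Owner.adversary} {m n : ℕ}
    {h : Finset.Iic m → V} {h' : Finset.Iic n → V} (hl : historyLast h = historyLast h')
    (hσ : σ.1 (historyList h) = σ'.1 (historyList h'))
    (hτ : τ.1 (historyList h) = τ'.1 (historyList h')) :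
    G.step σ τ m h = G.step σ' τ' n h' := by
  unfold step
  rw [hl, hσ, hτ]

theorem step_shift (σ : G.Strategy Owner.main) (τ : G.Strategy Owner.adversary)
    {n : ℕ} (h : ℕ → V) {v : V} (h0 : h 0 = v) :
    G.step σ τ (n + 1) (fun i => h i) =
      G.step (σ.shift v) (τ.shift v) n (fun i => h (i + 1)) := by
  have hl : historyLast (fun i : Finset.Iic (n + 1) => h i) =
      historyLast fun i : Finset.Iic n => h (i + 1) := by
    simp only [historyLast]
  refine step_congr hl ?_ ?_
  · rw [historyList_succ_eq_cons, h0, Strategy.shift]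
  · rw [historyList_succ_eq_cons, h0, Strategy.shift]

end Step

section Expectation

variable {V : Type*} [Fintype V] [MeasurableSpace V] [DiscreteMeasurableSpace V]
  {G : StochasticGame V}

variable (σ : G.Strategy Owner.main) (τ : G.Strategy Owner.adversary)

theorem step_zero_singleton {v : V} (hv : G.owner v = Owner.random) (w : V) :
    G.step σ τ 0 (fun _ => v) {w} = ENNReal.ofReal (G.prob v w : ℝ) := by
  classical
  have hl : historyLast (fun _ : Finset.Iic 0 => v) = v := rfl
  unfold step
  rw [hl, hv]
  simp only [Measure.finsetSum_apply, Measure.smul_apply, smul_eq_mul]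
  rw [Finset.sum_eq_single w]
  · simp
  · intro u _ huw
    simp [Measure.dirac_apply' u (measurableSet_singleton w), huw]
  · simp

theorem ae_edge_of_random {v : V} (hv : G.owner v = Owner.random) :
    ∀ᵐ x ∂Kernel.traj (X := fun _ => V) (G.stepKernel σ τ) 0 (fun _ => v), G.Edge v (x 1) := by
  have h1 : ∀ᵐ w ∂G.step σ τ 0 (fun _ => v), G.Edge v w := by
    rw [ae_iff_of_countable]
    intro w hw
    by_contra hvw
    rw [step_zero_singleton σ τ hv, G.prob_eq_zero v w hv hvw] at hw
    simp at hw
  have hm : Measurable fun x : ℕ → V => x (0 + 1) := measurable_pi_apply _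
  have h2 : (Kernel.traj (X := fun _ => V) (G.stepKernel σ τ) 0 (fun _ => v)).map
      (fun x => x (0 + 1)) = G.step σ τ 0 (fun _ => v) := by
    have h3 := Kernel.map_traj_succ_self (X := fun _ => V) (κ := G.stepKernel σ τ) (a := 0)
    rw [← Kernel.map_apply _ hm, h3]
    rfl
  rw [← h2] at h1
  exact ae_of_ae_map hm.aemeasurable h1

theorem measurableSet_range_play (G : StochasticGame V) :
    MeasurableSet {x : ℕ → V | ∀ i, G.Edge (x i) (x (i + 1))} := by
  rw [Set.ofPred_forall]
  refine MeasurableSet.iInter fun i => ?_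
  have h : Measurable fun x : ℕ → V => (x i, x (i + 1)) := by fun_prop
  exact h (Set.toFinite {e : V × V | G.Edge e.1 e.2}).measurableSet

theorem measurable_extendByZero {f : G.Play → ℝ} (hf : Measurable f) :
    Measurable (G.extendByZero f) :=
  (MeasurableEmbedding.subtype_coe (measurableSet_range_play G)).measurable_extend hf
    measurable_const

theorem integrable_extendByZero {f : G.Play → ℝ} (hf : Measurable f) {W : ℕ}
    (hW : ∀ ρ, |f ρ| ≤ W) (μ : Measure (ℕ → V)) [IsFiniteMeasure μ] :
    Integrable (G.extendByZero f) μ :=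
  Integrable.of_bound (measurable_extendByZero hf).aestronglyMeasurable W
    (ae_of_all _ fun x => abs_extendByZero_le hW x)

theorem expOutcome_eq_integral_traj (f : G.Play → ℝ) (v : V) :
    G.expOutcome f σ τ v = ∫ x, G.extendByZero f x
      ∂(Kernel.traj (X := fun _ => V) (G.stepKernel σ τ) 0 (fun _ => v)) := by
  rw [← setIntegral_eq_integral_of_forall_compl_eq_zero
      (s := {x : ℕ → V | ∀ i, G.Edge (x i) (x (i + 1))})
      fun x hx => extendByZero_of_not_edge f hx,
    ← integral_subtype_comap (measurableSet_range_play G)]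
  exact integral_congr_ae (ae_of_all _ fun ρ => (extendByZero_of_edge f ρ.2).symm)

theorem abs_expOutcome_le {f : G.Play → ℝ} {W : ℕ} (hW : ∀ ρ, |f ρ| ≤ W) (v : V) :
    |G.expOutcome f σ τ v| ≤ W := by
  rw [expOutcome_eq_integral_traj]
  rw [← Real.norm_eq_abs]
  refine (norm_integral_le_of_norm_le_const (C := W)
    (ae_of_all _ fun x => abs_extendByZero_le hW x)).trans ?_
  simp

/-- The expected value from `w` depends only on what the strategies do after histories that start
at `w`. -/
theorem expOutcome_congr {σ σ' : G.Strategy Owner.main} {τ τ' : G.Strategy Owner.adversary}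
    (f : G.Play → ℝ) {w : V} (hσ : ∀ l, σ.1 (w :: l) = σ'.1 (w :: l))
    (hτ : ∀ l, τ.1 (w :: l) = τ'.1 (w :: l)) :
    G.expOutcome f σ τ w = G.expOutcome f σ' τ' w := by
  rw [expOutcome_eq_integral_traj, expOutcome_eq_integral_traj,
    traj_congr_of_start (κ' := G.stepKernel σ' τ')]
  rintro n h rfl
  change G.step σ τ n _ = G.step σ' τ' n _
  apply step_congr rfl
  · rw [historyList_eq_cons]; exact hσ _
  · rw [historyList_eq_cons]; exact hτ _

theorem traj_stepKernel_map_shift {v : V} (hv : G.owner v = Owner.random) :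
    (Kernel.traj (X := fun _ => V) (G.stepKernel σ τ) 0 (fun _ => v)).map
        (fun x n => x (n + 1)) =
      ∑ w, ENNReal.ofReal (G.prob v w : ℝ) • Kernel.traj (X := fun _ => V)
        (G.stepKernel (σ.shift v) (τ.shift v)) 0 (fun _ => w) := by
  have hk : ∀ w, G.stepKernel σ τ 0 (fun _ => v) {w} = ENNReal.ofReal (G.prob v w : ℝ) :=
    fun w => step_zero_singleton σ τ hv w
  rw [traj_map_shift (κ' := G.stepKernel (σ.shift v) (τ.shift v))]
  · refine Finset.sum_congr rfl fun w _ => ?_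
    rw [hk w]
  · intro n h h0
    exact step_shift σ τ h h0

/-- A prefix-independent objective does not see the first vertex of a play, so that its expected
value from a probabilistic vertex is the average of those from the successors. -/
theorem expOutcome_eq_sum {f : G.Play → ℝ} (hf : Measurable f) (hbdd : ∃ W : ℕ, ∀ ρ, |f ρ| ≤ W)
    (hpre : G.PrefixIndependent f) {v : V} (hv : G.owner v = Owner.random) :
    G.expOutcome f σ τ v =
      ∑ w, (G.prob v w : ℝ) * G.expOutcome f (σ.shift v) (τ.shift v) w := by
  obtain ⟨W, hW⟩ := hbdd
  have hF := measurable_extendByZero hf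
  have hshift : Measurable fun (x : ℕ → V) n => x (n + 1) := by fun_prop
  have h1 : G.expOutcome f σ τ v = ∫ x, G.extendByZero f (fun n => x (n + 1))
      ∂(Kernel.traj (X := fun _ => V) (G.stepKernel σ τ) 0 (fun _ => v)) := by
    rw [expOutcome_eq_integral_traj]
    refine integral_congr_ae ?_
    filter_upwards [ae_edge_of_random σ τ hv, traj_ae_apply_zero (G.stepKernel σ τ) v]
      with x hx hx0
    refine extendByZero_shift hpre ?_
    rw [hx0]
    exact hx
  rw [h1, ← integral_map hshift.aemeasurable hF.aestronglyMeasurable,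
    traj_stepKernel_map_shift σ τ hv, integral_finsetSum_measure]
  · refine Finset.sum_congr rfl fun w _ => ?_
    rw [integral_smul_measure,
      ENNReal.toReal_ofReal (by exact_mod_cast prob_nonneg hv w), smul_eq_mul,
      expOutcome_eq_integral_traj]
  · exact fun w _ => (integrable_extendByZero hf hW _).smul_measure ENNReal.ofReal_ne_top

/-- The values of the vertices are harmonic at the probabilistic vertices. -/
theorem expValue_eq_sum {f : G.Play → ℝ} (hf : Measurable f) (hbdd : ∃ W : ℕ, ∀ ρ, |f ρ| ≤ W)
    (hpre : G.PrefixIndependent f) {v : V} (hv : G.owner v = Owner.random) :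
    G.expValue f v = ∑ w, (G.prob v w : ℝ) * G.expValue f w := by
  obtain ⟨W, hW⟩ := id hbdd
  have hne₁ := nonempty_strategy G Owner.main v
  have hne₂ := nonempty_strategy G Owner.adversary v
  have hprob : ∀ w, (0 : ℝ) ≤ G.prob v w := fun w => by exact_mod_cast prob_nonneg hv w
  have hsum : ∑ w, (G.prob v w : ℝ) = 1 := by exact_mod_cast G.prob_sum v hv
  have hbelow : ∀ σ w, BddBelow (Set.range fun τ => G.expOutcome f σ τ w) := fun σ w =>
    ⟨-W, Set.forall_mem_range.2 fun τ => (abs_le.1 (abs_expOutcome_le σ τ hW w)).1⟩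
  have habove : ∀ w, BddAbove (Set.range fun σ => ⨅ τ, G.expOutcome f σ τ w) := fun w =>
    ⟨W, Set.forall_mem_range.2 fun σ => (ciInf_le (hbelow σ w) hne₂.some).trans
      (abs_le.1 (abs_expOutcome_le σ _ hW w)).2⟩
  -- After the first move the strategies are arbitrary, by surjectivity of `Strategy.shift`, and only
  -- their behaviour after histories from `w` matters for the summand `w`, so both extrema may be
  -- taken in each summand separately.
  unfold expValue
  simp only [expOutcome_eq_sum _ _ hf hbdd hpre hv]
  rw [(Strategy.shift_surjective (v := v) (by simp [hv])).iSup_comp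
    (g := fun σ : G.Strategy Owner.main => ⨅ τ : G.Strategy Owner.adversary,
      ∑ w, (G.prob v w : ℝ) * G.expOutcome f σ (τ.shift v) w)]
  rw [← ciSup_sum_mul_of_glue hprob hsum habove]
  · refine congrArg _ (funext fun σ => ?_)
    rw [(Strategy.shift_surjective (v := v) (by simp [hv])).iInf_comp
      (g := fun τ : G.Strategy Owner.adversary =>
        ∑ w, (G.prob v w : ℝ) * G.expOutcome f σ τ w)]
    refine ciInf_sum_mul_of_glue hprob hsum (hbelow σ) fun s => ?_
    obtain ⟨t, ht⟩ := Strategy.exists_glue v s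
    exact ⟨t, fun w => expOutcome_congr f (fun _ => rfl) (ht w)⟩
  · intro s
    obtain ⟨t, ht⟩ := Strategy.exists_glue v s
    exact ⟨t, fun w => congrArg _ (funext fun τ => expOutcome_congr f (ht w) fun _ => rfl)⟩

end Expectation

end StochasticGame

/-! ### Denominators of the values -/

theorem mainTheorem4 {V : Type*} [Fintype V] [MeasurableSpace V] [DiscreteMeasurableSpace V]
    (G : StochasticGame V) (f : G.Play → ℝ) (hf : Measurable f)
    (hbdd : ∃ W : ℕ, ∀ ρ, |f ρ| ≤ W) (hpre : G.PrefixIndependent f)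
    (D : ℕ)
    (hD : ∀ v : V,
      (∀ u ∈ StochasticGame.valueClass (G.expValue f) v, ¬ G.IsBoundary (G.expValue f) u) →
        HasDenLE (G.expValue f v) D) :
    ∀ v : V, HasDenLE (G.expValue f v)
      (2 ^ Fintype.card V * G.maxProbDen ^ (Fintype.card V ^ 3) * D ^ Fintype.card V) := by
  classical
  intro v
  set r := G.expValue f with hr
  let K : V → Prop := fun v =>
    ∃ u, u ∈ StochasticGame.valueClass r v ∧ G.IsBoundary r u
  have hnot : ∀ v, ¬ K v → HasDenLE (r v) D := fun v hv =>
    hD v fun u hu hb => hv ⟨u, hu, hb⟩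
  -- A boundary vertex in the class of `v`, if there is one.
  let ρ : V → V := fun v => if hv : K v then hv.choose else v
  have hρ : ∀ v, K v → r (ρ v) = r v ∧ G.IsBoundary r (ρ v) := fun v hv => by
    simp only [ρ, dif_pos hv]
    exact hv.choose_spec
  have havg : ∀ v, K v → r (ρ v) = ∑ w, (G.prob (ρ v) w : ℝ) * r w := fun v hv =>
    StochasticGame.expValue_eq_sum hf hbdd hpre (hρ v hv).2.1
  have hup : ∀ v, K v → ∃ w, 0 < G.prob (ρ v) w ∧ r v < r w := fun v hv => by
    rw [← (hρ v hv).1]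
    exact (hρ v hv).2.exists_lt (havg v hv)
  -- The largest value class has no boundary vertex, so that `D` bounds some denominator.
  have hD1 : 1 ≤ D := by
    have : Nonempty V := ⟨v⟩
    obtain ⟨m, hm⟩ := Finite.exists_max r
    obtain ⟨q, -, hq⟩ := hnot m fun hK => by
      obtain ⟨w, -, hw⟩ := hup m hK
      exact (hm w).not_gt hw
    exact q.den_pos.trans_le hq
  obtain ⟨q, hq, hqd⟩ := hasDenLE_of_forall_eq_average r K (fun v w => G.prob (ρ v) w)
    (fun v hv w => StochasticGame.prob_nonneg (hρ v hv).2.1 w)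
    (fun v hv => G.prob_sum _ (hρ v hv).2.1)
    (fun v hv => (hρ v hv).1.symm.trans (havg v hv)) hup
    (StochasticGame.one_le_maxProbDen G)
    (fun v hv => StochasticGame.den_prob_le_maxProbDen (hρ v hv).2.1) hD1 hnot v
  refine ⟨q, hq, hqd.trans ?_⟩
  have hcard : 0 < Fintype.card V := Fintype.card_pos_iff.2 ⟨v⟩
  have hpow : G.maxProbDen ^ Fintype.card V ^ 2 ≤ G.maxProbDen ^ Fintype.card V ^ 3 :=
    Nat.pow_le_pow_right (StochasticGame.one_le_maxProbDen G)
      (Nat.pow_le_pow_right hcard (by norm_num))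
  gcongr
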